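/- Let $N>1$ and $d\ge 1$ be integers, write $e_M(x)=e^{2\pi i x/M}$, and let $\mathcal H_N=L^2((\mathbb Z/N\mathbb Z)^d)$ with inner product $\langle\psi,\phi\rangle=N^{-d}\sum_{x}\psi(x)\overline{\phi(x)}$. For $n=(n_1,n_2)\in\mathbb Z^d\times\mathbb Z^d=\mathbb Z^{2d}$ let $T_N(n)$ be the operator on $\mathcal H_N$ $$T_N(n)\psi(y)=(-1)^{N\,n_1\cdot n_2}\,e_{2N}(n_1\cdot n_2)\,e_N(n_2\cdot y)\,\psi(y+n_1),$$ which depends only on $n$ modulo $M$, where $M=N$ if $N$ is odd and $M=2N$ if $N$ is even. For $A\in\mathrm{Sp}(2d,\mathbb Z/M\mathbb Z)$, a quantum propagator for $A$ is a unitary operator $U_N(A)$ on $\mathcal H_N$ such that $$U_N(A)^{-1}\,T_N(n)\,U_N(A)=T_N(nA)\qquad\text{for all } n\in\mathbb Z^{2d}$$ ($n$ is regarded as a row vector). Let $G_N=\mathrm{Sp}(2d,\mathbb Z/N\mathbb Z)$ if $N$ is odd, and let $G_N$ be the subgroup of $\mathrm{Sp}(2d,\mathbb Z/2N\mathbb Z)$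 of all matrices congruent to $I$ or to $-I$ modulo $4$ if $N$ is even. **Theorem.** For every $N>1$ the phases of the propagators can be chosen so that $A\mapsto U_N(A)$ is a representation of $G_N$ on $\mathcal H_N$. Precisely: (1) there is a representation $A\mapsto U_N(A)$ of $G_N$ on $\mathcal H_N$ such that $U_N(A)$ is a quantum propagator for $A$, for every $A\in G_N$; and (2) for any choice of a quantum propagator $U_N(A)$ for each $A\in G_N$ there are complex numbers $c(A)$ with $|c(A)|=1$ $(A\in G_N)$ such that $A\mapsto c(A)U_N(A)$ is a representation of $G_N$. -/

import Mathlib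

open Matrix

/-- The space `H_N = L²((ℤ/Nℤ)^d)` of quantum states, of dimension `N ^ d`. -/
abbrev StateSpace (N d : ℕ) : Type := (Fin d → ZMod N) → ℂ

/-- The inner product `⟨ψ, φ⟩ = N^{-d} ∑_x ψ(x) conj(φ(x))` of `H_N`. -/
noncomputable def stateInner {N d : ℕ} [NeZero N] (ψ φ : StateSpace N d) : ℂ :=
  (1 / (N : ℂ) ^ d) * ∑ x : Fin d → ZMod N, ψ x * (starRingEnd ℂ) (φ x)

/-- Unitary operators of `H_N`: linear bijections preserving the inner product. -/
def IsUnitaryOperator {N d : ℕ} [NeZero N] (U : Module.End ℂ (StateSpace N d)) : Prop :=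
  Function.Bijective U ∧ ∀ ψ φ, stateInner (U ψ) (U φ) = stateInner ψ φ

/-- The elementary operator attached to `n = (n₁, n₂) ∈ ℤ^d × ℤ^d`,
`ψ ↦ (y ↦ e_{2N}(n₁ · n₂) e_N(n₂ · y) ψ(y + n₁))`, where `e_M(x) = exp(2πix/M)`
(`ZMod.stdAddChar` on `ZMod M`). -/
noncomputable def elemOp (N : ℕ) [NeZero N] {d : ℕ} (n : Fin d ⊕ Fin d → ℤ) :
    Module.End ℂ (StateSpace N d) where
  toFun ψ y :=
    ZMod.stdAddChar (((n ∘ Sum.inl) ⬝ᵥ (n ∘ Sum.inr) : ℤ) : ZMod (2 * N)) *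
      ZMod.stdAddChar ((fun i => (n (Sum.inr i) : ZMod N)) ⬝ᵥ y) *
      ψ (y + fun i => (n (Sum.inl i) : ZMod N))
  map_add' ψ φ := by
    ext y; simp only [Pi.add_apply]; ring
  map_smul' c ψ := by
    ext y; simp only [Pi.smul_apply, smul_eq_mul, RingHom.id_apply]; ring

/-- The twisted elementary operator `T_N(n) = (-1)^{N n₁ · n₂} · elemOp N n`. -/
noncomputable def twistedOp (N : ℕ) [NeZero N] {d : ℕ} (n : Fin d ⊕ Fin d → ℤ) :
    Module.End ℂ (StateSpace N d) :=
  ((-1 : ℂ) ^ ((N : ℤ) * ((n ∘ Sum.inl) ⬝ᵥ (n ∘ Sum.inr)))) • elemOp N n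

/-- `U` is a quantum propagator for the matrix `A` over `ℤ/Mℤ` (`M = N` for odd `N`, `M = 2N` for
even `N`): it is unitary and `U T_N(nA) = T_N(n) U` for all `n ∈ ℤ^{2d}`, i.e.
`U⁻¹ T_N(n) U = T_N(nA)`. Vectors are rows, and `m` runs over all the integral representatives of
`nA ∈ (ℤ/Mℤ)^{2d}`; the operator `T_N(m)` does not depend on which one is taken. -/
def IsPropagator (N : ℕ) [NeZero N] {d M : ℕ} (A : Matrix (Fin d ⊕ Fin d) (Fin d ⊕ Fin d) (ZMod M))
    (U : Module.End ℂ (StateSpace N d)) : Prop :=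
  IsUnitaryOperator U ∧
    ∀ n m : Fin d ⊕ Fin d → ℤ,
      (fun i => (m i : ZMod M)) = (fun i => (n i : ZMod M)) ᵥ* A →
        U * twistedOp N m = twistedOp N n * U

/-- The subgroup of `Sp(2d, ℤ/Mℤ)` of the matrices congruent to `I` or to `-I` modulo `m`,
for `m ∣ M`. -/
def pmOneSubgroup (d : ℕ) {m M : ℕ} (h : m ∣ M) :
    Subgroup (symplecticGroup (Fin d) (ZMod M)) where
  carrier := {A | (A : Matrix (Fin d ⊕ Fin d) (Fin d ⊕ Fin d) (ZMod M)).map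
      (ZMod.castHom h (ZMod m)) = 1 ∨
    (A : Matrix (Fin d ⊕ Fin d) (Fin d ⊕ Fin d) (ZMod M)).map (ZMod.castHom h (ZMod m)) = -1}
  one_mem' := Or.inl (Matrix.map_one _ (map_zero _) (map_one _))
  mul_mem' {A B} hA hB := by
    simp only [Set.mem_ofPred_eq, Submonoid.coe_mul, Matrix.map_mul] at *
    rcases hA with hA | hA <;> rcases hB with hB | hB <;> simp [hA, hB]
  inv_mem' {A} hA := by
    simp only [Set.mem_ofPred_eq] at *
    have h1 : ((A⁻¹ * A : symplecticGroup (Fin d) (ZMod M)) :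
        Matrix (Fin d ⊕ Fin d) (Fin d ⊕ Fin d) (ZMod M)).map (ZMod.castHom h (ZMod m)) = 1 := by
      rw [inv_mul_cancel]; exact Matrix.map_one _ (map_zero _) (map_one _)
    rw [Submonoid.coe_mul, Matrix.map_mul] at h1
    rcases hA with hA | hA
    · left; simpa [hA] using h1
    · right; rw [hA, mul_neg, mul_one] at h1; rw [← h1, neg_neg]

theorem four_dvd_two_mul_of_even {N : ℕ} (h : Even N) : 4 ∣ 2 * N := by
  obtain ⟨k, rfl⟩ := h
  exact ⟨k, by ring⟩

/-!
Averaging `T(k) Y T(-kA)` over `k` yields operators `X` with `X T(nA) = T(n) X`, which cannot all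
vanish because the traces of the Weyl operators would then satisfy a false identity. By Schur's
lemma such an `X` is unique up to a scalar and proportional to a unitary operator, so that the
propagators form a projective representation.

To remove the cocycle, write `N = q * r * m` with `m` odd (`q = r = 1` for odd `N`, and `r = q` or
`r = 2 * q` for even `N`). The group preserves the vectors `(r * m * a, q * m * b)` of phase one,
so that the propagators preserve the space fixed by their Weyl operators. This space consists of
the functions on a quotient group isomorphic to `(ℤ/mℤ)^d`, the only self-opposite element of which
is `0`: the dimensions of its even and odd parts differ by one. This forces the propagators to
commute with the parity operator, so they act on both parts, and dividing each propagator by the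
quotient of its determinants on the even and on the odd part yields a representation. As the group
is finite, the scalars have modulus one.
-/

/-! ### Linear algebra -/

section Determinant

variable {K V G : Type*} [Field K] [AddCommGroup V] [Module K V]

theorem det_restrict_ne_zero [FiniteDimensional K V] {f : Module.End K V}
    (hf : Function.Injective f) {E : Submodule K V} (hE : ∀ v ∈ E, f v ∈ E) :
    LinearMap.det (f.restrict hE) ≠ 0 :=
  have hinj : Function.Injective (f.restrict hE) := fun _ _ h =>
    Subtype.ext (hf (congrArg Subtype.val h))
  (LinearEquiv.isUnit_det' (LinearEquiv.ofInjectiveEndo _ hinj)).ne_zero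

theorem det_restrict_mul_det_restrict {E : Submodule K V} {f g k : Module.End K V} {c : K}
    (hf : ∀ v ∈ E, f v ∈ E) (hg : ∀ v ∈ E, g v ∈ E) (hk : ∀ v ∈ E, k v ∈ E)
    (h : f * g = c • k) :
    LinearMap.det (f.restrict hf) * LinearMap.det (g.restrict hg) =
      c ^ Module.finrank K E * LinearMap.det (k.restrict hk) := by
  rw [← map_mul, ← LinearMap.det_smul]
  congr 1
  exact LinearMap.ext fun v => Subtype.ext (LinearMap.congr_fun h v)

/-- A cocycle scales the determinants on `E` and `F` by its powers of exponents `dim E` and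
`dim F = dim E - 1`, so that dividing by their quotient removes it. -/
theorem exists_monoidHom_smul_of_finrank_eq_add_one [Group G] [FiniteDimensional K V]
    {U : G → Module.End K V} (hU : ∀ g, Function.Injective (U g))
    (hmul : ∀ g k, ∃ c : K, U g * U k = c • U (g * k)) {E F : Submodule K V}
    (hE : ∀ g, ∀ v ∈ E, U g v ∈ E) (hF : ∀ g, ∀ v ∈ F, U g v ∈ F)
    (hEF : Module.finrank K E = Module.finrank K F + 1) :
    ∃ (c : G → K) (ρ : G →* Module.End K V), ∀ g, ρ g = c g • U g := by
  let a g := LinearMap.det ((U g).restrict (hE g))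
  let b g := LinearMap.det ((U g).restrict (hF g))
  have ha g : a g ≠ 0 := det_restrict_ne_zero (hU g) (hE g)
  have hb g : b g ≠ 0 := det_restrict_ne_zero (hU g) (hF g)
  have hmul' g k : (b g / a g) • U g * (b k / a k) • U k = (b (g * k) / a (g * k)) • U (g * k) := by
    obtain ⟨c, hc⟩ := hmul g k
    have hak : a g * a k = c ^ (Module.finrank K F + 1) * a (g * k) :=
      hEF ▸ det_restrict_mul_det_restrict (hE g) (hE k) (hE _) hc
    have hbk : b g * b k = c ^ Module.finrank K F * b (g * k) :=
      det_restrict_mul_det_restrict (hF g) (hF k) (hF _) hc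
    have hc₀ : c ≠ 0 := by
      rintro rfl
      simp [ha] at hak
    have hagk := ha (g * k)
    rw [smul_mul_smul_comm, hc, smul_smul, div_mul_div_comm, hak, hbk]
    congr 1
    field_simp
    ring
  have hone : (b 1 / a 1) • U 1 = 1 := by
    have hinj : Function.Injective ((b 1 / a 1) • U 1) :=
      (smul_right_injective V (div_ne_zero (hb 1) (ha 1))).comp (hU 1)
    have hidem := hmul' 1 1
    rw [mul_one] at hidem
    exact LinearMap.ext fun v => hinj (LinearMap.congr_fun hidem v)
  exact ⟨fun g => b g / a g,
    { toFun := fun g => (b g / a g) • U g, map_one' := hone,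
      map_mul' := fun g k => (hmul' g k).symm }, fun _ => rfl⟩

end Determinant

section Involution

variable {K V : Type*} [Field K] [AddCommGroup V] [Module K V]

theorem commute_of_mul_eq_smul_mul [FiniteDimensional K V] {P U : Module.End K V} {c : K}
    {W : Submodule K V} (hP : P * P = 1) (hU : Function.Injective U) (hW : ∀ v ∈ W, U v ∈ W)
    (hPU : P * U = c • (U * P))
    (hdim : Module.finrank K (W ⊓ P.eigenspace (-1) : Submodule K V) <
      Module.finrank K (W ⊓ P.eigenspace 1 : Submodule K V)) : Commute P U := by
  have hPU' (v : V) : P (U v) = c • U (P v) := LinearMap.congr_fun hPU v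
  have hPP (v : V) : P (P v) = v := LinearMap.congr_fun hP v
  have hcc : c * c = 1 := by
    obtain ⟨v, hv⟩ : ∃ v : V, v ≠ 0 := by
      by_contra! h
      have : Subsingleton V := ⟨fun x y => (h x).trans (h y).symm⟩
      simp [Module.finrank_zero_of_subsingleton] at hdim
    have hUv : U v ≠ 0 := (map_ne_zero_iff U hU).2 hv
    have h : (c * c) • U v = (1 : K) • U v := by
      calc (c * c) • U v = c • P (U (P v)) := by rw [hPU', hPP, smul_smul]
        _ = (1 : K) • U v := by rw [← map_smul, ← hPU', hPP, one_smul]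
    exact smul_left_injective K hUv h
  rcases mul_self_eq_one_iff.1 hcc with rfl | rfl
  · rwa [one_smul] at hPU
  · have hmaps : ∀ v ∈ W ⊓ P.eigenspace 1, U v ∈ W ⊓ P.eigenspace (-1) := by
      rintro v ⟨hvW, hv⟩
      rw [SetLike.mem_coe, Module.End.mem_eigenspace_iff, one_smul] at hv
      exact ⟨hW v hvW, Module.End.mem_eigenspace_iff.2 (by rw [hPU', hv])⟩
    have hinj : Function.Injective (U.restrict hmaps) := fun _ _ h =>
      Subtype.ext (hU (congrArg Subtype.val h))
    exact absurd (LinearMap.finrank_le_finrank_of_injective hinj) hdim.not_ge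

end Involution

section Averaging

theorem mul_sum_mul_mul_neg {R K V : Type*} [CommSemiring K] [Semiring R] [Algebra K R]
    [AddCommGroup V] [Fintype V] {S T : V → R} {β : V → V → K}
    (hS : ∀ n k, S n * S k = β n k • S (n + k)) (hT : ∀ n k, T n * T k = β n k • T (n + k))
    (hβ : ∀ n k, β (-(n + k)) n = β n k) (Y : R) (n : V) :
    S n * ∑ k, S k * Y * T (-k) = (∑ k, S k * Y * T (-k)) * T n := by
  rw [Finset.mul_sum, Finset.sum_mul, ← Equiv.sum_comp (Equiv.addLeft n) fun k => _ * T n]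
  refine Finset.sum_congr rfl fun k _ => ?_
  have hneg : -(n + k) + n = -k := by abel
  calc S n * (S k * Y * T (-k)) = β n k • (S (n + k) * Y * T (-k)) := by
        rw [← mul_assoc, ← mul_assoc, hS, smul_mul_assoc, smul_mul_assoc]
    _ = S (n + k) * Y * T (-(n + k)) * T n := by
        rw [mul_assoc _ _ (T n), hT, hβ, hneg, mul_smul_comm]

theorem sum_trace_mul_trace_eq_zero {ι n R : Type*} [Fintype n] [CommSemiring R]
    {s : Finset ι} {A B : ι → Matrix n n R}
    (h : ∀ Y : Matrix n n R, ∑ k ∈ s, A k * Y * B k = 0) :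
    ∑ k ∈ s, (A k).trace * (B k).trace = 0 := by
  classical
  have hentry (i j : n) : ∑ k ∈ s, A k i i * B k j j = 0 := by
    have hij := congrFun₂ (h (Matrix.single i j 1)) i j
    simpa [Matrix.sum_apply, Matrix.mul_assoc, Matrix.mul_apply, Matrix.single_apply, ite_and]
      using hij
  calc ∑ k ∈ s, (A k).trace * (B k).trace
      = ∑ i, ∑ j, ∑ k ∈ s, A k i i * B k j j := by
        simp only [Matrix.trace, Matrix.diag_apply, Finset.sum_mul_sum]
        rw [Finset.sum_comm]
        exact Finset.sum_congr rfl fun i _ => Finset.sum_comm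
    _ = 0 := by simp only [hentry, Finset.sum_const_zero]

theorem sum_linearMap_trace_mul_trace_eq_zero {ι R M : Type*} [CommRing R] [AddCommGroup M]
    [Module R M] [Module.Free R M] [Module.Finite R M] {s : Finset ι} {A B : ι → Module.End R M}
    (h : ∀ Y : Module.End R M, ∑ k ∈ s, A k * Y * B k = 0) :
    ∑ k ∈ s, LinearMap.trace R M (A k) * LinearMap.trace R M (B k) = 0 := by
  classical
  let b := Module.Free.chooseBasis R M
  let e := LinearMap.toMatrixAlgEquiv b
  have htrace (f : Module.End R M) : LinearMap.trace R M f = (e f).trace :=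
    LinearMap.trace_eq_matrix_trace R b f
  simp only [htrace]
  refine sum_trace_mul_trace_eq_zero fun Y => ?_
  simpa using congrArg e (h (e.symm Y))

end Averaging

/-! ### Parity and coset spaces -/

section CosetSpace

variable {K V : Type*} [Field K] [AddCommGroup V] {q m : ℕ}

/-- The parity operator `ψ ↦ (y ↦ ψ (-y))`. -/
def parityOp (K V : Type*) [Semiring K] [Neg V] : Module.End K (V → K) :=
  LinearMap.funLeft K K Neg.neg

theorem parityOp_apply (ψ : V → K) (y : V) : parityOp K V ψ y = ψ (-y) := rfl

theorem parityOp_mul_self : parityOp K V * parityOp K V = 1 :=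
  LinearMap.ext fun ψ => funext fun y => congrArg ψ (neg_neg y)

theorem isUnit_parityOp : IsUnit (parityOp K V) :=
  ⟨⟨_, _, parityOp_mul_self, parityOp_mul_self⟩, rfl⟩

theorem mem_eigenspace_parityOp {ψ : V → K} {ε : K} :
    ψ ∈ (parityOp K V).eigenspace ε ↔ ∀ y, ψ (-y) = ε * ψ y := by
  rw [Module.End.mem_eigenspace_iff, funext_iff]
  rfl

/-- The space of functions on `V` supported on the `q * m`-torsion and invariant under translation
by the `q`-torsion, that is, of functions on the quotient of the former by the latter. -/
def cosetSpace (K V : Type*) [Semiring K] [AddCommMonoid V] (q m : ℕ) : Submodule K (V → K) where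
  carrier := {ψ | (∀ y, (q * m) • y ≠ 0 → ψ y = 0) ∧ ∀ y z, q • z = 0 → ψ (y + z) = ψ y}
  zero_mem' := ⟨fun _ _ => rfl, fun _ _ _ => rfl⟩
  add_mem' hψ hφ :=
    ⟨fun y hy => by rw [Pi.add_apply, hψ.1 y hy, hφ.1 y hy, add_zero],
      fun y z hz => congrArg₂ (· + ·) (hψ.2 y z hz) (hφ.2 y z hz)⟩
  smul_mem' c ψ hψ :=
    ⟨fun y hy => by rw [Pi.smul_apply, hψ.1 y hy, smul_zero],
      fun y z hz => congrArg (c • ·) (hψ.2 y z hz)⟩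

theorem apply_eq_apply_zero_of_mem_cosetSpace {ψ : V → K} (hψ : ψ ∈ cosetSpace K V q m) {y : V}
    (hy : q • y = 0) : ψ y = ψ 0 := by
  simpa only [zero_add] using hψ.2 0 y hy

theorem exists_odd_sign (R V : Type*) [Ring R] [AddGroup V] :
    ∃ g : V → R, g 0 = 0 ∧ (∀ v, g (-v) = -g v) ∧ ∀ v, v ≠ -v → g v * g v = 1 := by
  classical
  let _ : LinearOrder V := linearOrderOfSTO WellOrderingRel
  refine ⟨fun v => if v < -v then 1 else if -v < v then -1 else 0, by simp, fun v => ?_,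
    fun v hv => ?_⟩
  · rcases lt_trichotomy v (-v) with h | h | h
    · simp [h, h.not_gt]
    · simp [← h]
    · simp [h, h.not_gt]
  · rcases lt_or_gt_of_ne hv with h | h
    · simp [h]
    · simp [h, h.not_gt]

/-- A sign function on the nonzero cosets of the `q`-torsion in the `q * m`-torsion of `V`, odd and
vanishing on the zero coset. Multiplication by it exchanges the even and the odd functions of
`cosetSpace K V q m`. -/
structure IsOddCosetSign {K V : Type*} [Ring K] [AddCommGroup V] (σ : V → K) (q m : ℕ) : Prop where
  apply_eq_zero : ∀ y, q • y = 0 → σ y = 0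
  apply_neg : ∀ y, σ (-y) = -σ y
  apply_add : ∀ y z, q • z = 0 → σ (y + z) = σ y
  mul_self : ∀ y, (q * m) • y = 0 → q • y ≠ 0 → σ y * σ y = 1

theorem exists_isOddCosetSign (R V : Type*) [Ring R] [AddCommGroup V] (q : ℕ) {m : ℕ}
    (hm : Odd m) : ∃ σ : V → R, IsOddCosetSign σ q m := by
  obtain ⟨g, hg_zero, hg_neg, hg_sq⟩ := exists_odd_sign R V
  refine ⟨fun y => g (q • y), fun y hy => by simp only [hy, hg_zero],
    fun y => by simp only [smul_neg, hg_neg], fun y z hz => by simp only [smul_add, hz, add_zero],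
    fun y hy hne => hg_sq _ fun hself => hne ?_⟩
  obtain ⟨k, rfl⟩ := hm
  have h_two : 2 • q • y = 0 := by
    rw [two_nsmul]
    exact add_eq_zero_iff_eq_neg.2 hself
  rwa [mul_comm, mul_smul, add_smul, one_smul, mul_comm, mul_smul, h_two, smul_zero,
    zero_add] at hy

namespace IsOddCosetSign

variable {σ ψ : V → K} (hσ : IsOddCosetSign σ q m)

include hσ

theorem mul_mem {ε : K} (hψ : ψ ∈ cosetSpace K V q m ⊓ (parityOp K V).eigenspace ε) :
    σ * ψ ∈ cosetSpace K V q m ⊓ (parityOp K V).eigenspace (-ε) := by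
  refine ⟨⟨fun y hy => ?_, fun y z hz => ?_⟩, mem_eigenspace_parityOp.2 fun y => ?_⟩
  · rw [Pi.mul_apply, hψ.1.1 y hy, mul_zero]
  · rw [Pi.mul_apply, Pi.mul_apply, hσ.apply_add y z hz, hψ.1.2 y z hz]
  · rw [Pi.mul_apply, Pi.mul_apply, hσ.apply_neg, mem_eigenspace_parityOp.1 hψ.2]
    ring

theorem mul_mul_apply (hψ : ψ ∈ cosetSpace K V q m) {y : V} (hy : q • y ≠ 0) :
    σ y * (σ y * ψ y) = ψ y := by
  by_cases hqm : (q * m) • y = 0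
  · rw [← mul_assoc, hσ.mul_self y hqm hy, one_mul]
  · rw [hψ.1 y hqm, mul_zero, mul_zero]

theorem mul_mul_eq_self (hK : ringChar K ≠ 2)
    (hψ : ψ ∈ cosetSpace K V q m ⊓ (parityOp K V).eigenspace (-1)) : σ * (σ * ψ) = ψ := by
  have hψ_zero : ψ 0 = 0 := by
    have h := mem_eigenspace_parityOp.1 hψ.2 0
    rw [neg_zero, neg_one_mul] at h
    exact (Ring.eq_self_iff_eq_zero_of_char_ne_two hK).1 h.symm
  funext y
  by_cases hy : q • y = 0
  · rw [Pi.mul_apply, hσ.apply_eq_zero y hy, zero_mul,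
      apply_eq_apply_zero_of_mem_cosetSpace hψ.1 hy, hψ_zero]
  · exact hσ.mul_mul_apply hψ.1 hy

theorem mul_eq_zero_iff (hψ : ψ ∈ cosetSpace K V q m) :
    σ * ψ = 0 ↔ ∃ c : K, c • {y | q • y = 0}.indicator 1 = ψ := by
  constructor
  · refine fun h => ⟨ψ 0, funext fun y => ?_⟩
    by_cases hy : q • y = 0
    · simp [hy, apply_eq_apply_zero_of_mem_cosetSpace hψ hy]
    · have hy_zero : σ y * ψ y = 0 := congrFun h y
      rw [← hσ.mul_mul_apply hψ hy, hy_zero]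
      simp [hy]
  · rintro ⟨c, rfl⟩
    funext y
    by_cases hy : q • y = 0 <;> simp [hy, hσ.apply_eq_zero]

end IsOddCosetSign

theorem indicator_torsion_mem_cosetSpace_inf_even :
    {y : V | q • y = 0}.indicator 1 ∈ cosetSpace K V q m ⊓ (parityOp K V).eigenspace 1 := by
  classical
  refine ⟨⟨fun y hy => Set.indicator_of_notMem (fun h => hy ?_) _, fun y z hz => ?_⟩,
    mem_eigenspace_parityOp.2 fun y => ?_⟩
  · rw [mul_comm, mul_smul, h, smul_zero]
  · simp [Set.indicator_apply, hz]
  · simp [Set.indicator_apply]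

theorem finrank_cosetSpace_inf_even_eq_finrank_odd_add_one [Finite V] (hK : ringChar K ≠ 2)
    (hm : Odd m) :
    Module.finrank K (cosetSpace K V q m ⊓ (parityOp K V).eigenspace 1 : Submodule K (V → K)) =
      Module.finrank K
        (cosetSpace K V q m ⊓ (parityOp K V).eigenspace (-1) : Submodule K (V → K)) + 1 := by
  obtain ⟨σ, hσ⟩ := exists_isOddCosetSign K V q hm
  let f := (LinearMap.mulLeft K σ).restrict fun ψ => hσ.mul_mem (ε := 1) (ψ := ψ)
  have hf_surj : Function.Surjective f := fun φ =>
    ⟨⟨σ * φ.1, by simpa only [neg_neg] using hσ.mul_mem φ.2⟩,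
      Subtype.ext (hσ.mul_mul_eq_self hK φ.2)⟩
  have hf_ker : Module.finrank K f.ker = 1 := by
    let δ : f.ker := ⟨⟨_, indicator_torsion_mem_cosetSpace_inf_even⟩, Subtype.ext <|
      (hσ.mul_eq_zero_iff indicator_torsion_mem_cosetSpace_inf_even.1).2 ⟨1, one_smul K _⟩⟩
    refine finrank_eq_one δ (fun h => ?_) fun ψ => ?_
    · have h_zero : {y : V | q • y = 0}.indicator 1 0 = (0 : K) :=
        congrArg (fun ψ : f.ker => ψ.1.1 0) h
      simp at h_zero
    · obtain ⟨c, hc⟩ := (hσ.mul_eq_zero_iff ψ.1.2.1).1 (congrArg Subtype.val ψ.2)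
      exact ⟨c, Subtype.ext (Subtype.ext hc)⟩
  rw [← f.finrank_range_add_finrank_ker, LinearMap.range_eq_top.2 hf_surj, finrank_top, hf_ker]

end CosetSpace

/-! ### Unitary operators of the state space -/

section Unitary

variable {N d : ℕ} [NeZero N]

theorem stateInner_eq_dotProduct_star (ψ φ : StateSpace N d) :
    stateInner ψ φ = ((N : ℂ) ^ d)⁻¹ * (ψ ⬝ᵥ star φ) := by
  rw [stateInner, one_div]
  rfl

theorem stateInner_smul_smul (c : ℂ) (ψ φ : StateSpace N d) :
    stateInner (c • ψ) (c • φ) = (‖c‖ : ℂ) ^ 2 * stateInner ψ φ := by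
  rw [stateInner_eq_dotProduct_star, stateInner_eq_dotProduct_star, star_smul, smul_dotProduct,
    dotProduct_smul, ← Complex.mul_conj']
  simp only [smul_eq_mul, starRingEnd_apply]
  ring

open scoped ComplexOrder in
theorem exists_pos_stateInner_self_eq {ψ : StateSpace N d} (hψ : ψ ≠ 0) :
    ∃ r : ℝ, 0 < r ∧ stateInner ψ ψ = r := by
  have hpos : 0 < stateInner ψ ψ := by
    rw [stateInner_eq_dotProduct_star]
    have hN : (0 : ℂ) < N := Nat.cast_pos.2 (NeZero.pos N)
    exact mul_pos (inv_pos.2 (pow_pos hN d)) (dotProduct_self_star_pos_iff.2 hψ)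
  obtain ⟨r, hr, h⟩ := RCLike.pos_iff_exists_ofReal.1 hpos
  exact ⟨r, hr, h.symm⟩

theorem stateInner_self_ne_zero {ψ : StateSpace N d} (hψ : ψ ≠ 0) : stateInner ψ ψ ≠ 0 := by
  obtain ⟨r, hr, h⟩ := exists_pos_stateInner_self_eq hψ
  rw [h]
  exact_mod_cast hr.ne'

theorem isUnitaryOperator_of_isometry {U : Module.End ℂ (StateSpace N d)}
    (hU : ∀ ψ φ, stateInner (U ψ) (U φ) = stateInner ψ φ) : IsUnitaryOperator U := by
  have hinj : Function.Injective U := (injective_iff_map_eq_zero U).2 fun ψ hψ => by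
    by_contra hne
    refine stateInner_self_ne_zero hne ?_
    rw [← hU, hψ, stateInner_eq_dotProduct_star, zero_dotProduct, mul_zero]
  exact ⟨⟨hinj, LinearMap.injective_iff_surjective.1 hinj⟩, hU⟩

namespace IsUnitaryOperator

variable {U V : Module.End ℂ (StateSpace N d)}

theorem one : IsUnitaryOperator (1 : Module.End ℂ (StateSpace N d)) :=
  isUnitaryOperator_of_isometry fun _ _ => rfl

theorem mul (hU : IsUnitaryOperator U) (hV : IsUnitaryOperator V) : IsUnitaryOperator (U * V) :=
  isUnitaryOperator_of_isometry fun ψ φ => (hU.2 _ _).trans (hV.2 ψ φ)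

theorem pow (hU : IsUnitaryOperator U) (n : ℕ) : IsUnitaryOperator (U ^ n) := by
  induction n with
  | zero => exact one
  | succ n ih => exact pow_succ U n ▸ ih.mul hU

theorem smul (hU : IsUnitaryOperator U) {c : ℂ} (hc : ‖c‖ = 1) : IsUnitaryOperator (c • U) :=
  isUnitaryOperator_of_isometry fun ψ φ => by
    rw [LinearMap.smul_apply, LinearMap.smul_apply, stateInner_smul_smul, hU.2, hc,
      Complex.ofReal_one, one_pow, one_mul]

theorem norm_eq_one_of_smul (hU : IsUnitaryOperator U) {c : ℂ} (hc : IsUnitaryOperator (c • U)) :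
    ‖c‖ = 1 := by
  have hψ : (1 : StateSpace N d) ≠ 0 := one_ne_zero
  have h := hc.2 1 1
  rw [LinearMap.smul_apply, stateInner_smul_smul, hU.2] at h
  have hsq : (‖c‖ : ℂ) ^ 2 = 1 := (mul_eq_right₀ (stateInner_self_ne_zero hψ)).1 h
  exact (pow_eq_one_iff_of_nonneg (norm_nonneg c) two_ne_zero).1 (by exact_mod_cast hsq)

theorem norm_eq_one_of_smul_pow_eq_one (hU : IsUnitaryOperator U) {c : ℂ} {n : ℕ} (hn : n ≠ 0)
    (hc : (c • U) ^ n = 1) : ‖c‖ = 1 := by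
  rw [smul_pow] at hc
  have h := (hU.pow n).norm_eq_one_of_smul (hc ▸ one)
  rw [norm_pow] at h
  exact (pow_eq_one_iff_of_nonneg (norm_nonneg c) hn).1 h

theorem isUnit (hU : IsUnitaryOperator U) : IsUnit U := (Module.End.isUnit_iff U).2 hU.1

end IsUnitaryOperator

/-- The adjoint for `stateInner`, given by the conjugate transpose since `stateInner` is a multiple
of the standard inner product. -/
def adjointOp (X : Module.End ℂ (StateSpace N d)) : Module.End ℂ (StateSpace N d) :=
  Matrix.toLin' (LinearMap.toMatrix' X)ᴴ

theorem adjointOp_mul (X Y : Module.End ℂ (StateSpace N d)) :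
    adjointOp (X * Y) = adjointOp Y * adjointOp X := by
  rw [adjointOp, LinearMap.toMatrix'_mul, conjTranspose_mul, Matrix.toLin'_mul]
  rfl

theorem stateInner_apply_left (X : Module.End ℂ (StateSpace N d)) (ψ φ : StateSpace N d) :
    stateInner (X ψ) φ = stateInner ψ (adjointOp X φ) := by
  rw [stateInner_eq_dotProduct_star, stateInner_eq_dotProduct_star, adjointOp,
    Matrix.toLin'_apply, star_mulVec, conjTranspose_conjTranspose,
    ← LinearMap.toMatrix'_mulVec X ψ, dotProduct_comm, dotProduct_mulVec, dotProduct_comm]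

theorem eq_of_stateInner_eq {φ φ' : StateSpace N d} (h : ∀ ψ, stateInner ψ φ = stateInner ψ φ') :
    φ = φ' := by
  have hN : ((N : ℂ) ^ d)⁻¹ ≠ 0 := inv_ne_zero (pow_ne_zero d (Nat.cast_ne_zero.2 (NeZero.ne N)))
  refine star_injective (dotProduct_eq _ _ fun ψ => ?_)
  have hψ := h ψ
  rw [stateInner_eq_dotProduct_star, stateInner_eq_dotProduct_star] at hψ
  rw [dotProduct_comm, mul_left_cancel₀ hN hψ, dotProduct_comm]

theorem IsUnitaryOperator.adjointOp_mul_self {U : Module.End ℂ (StateSpace N d)}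
    (hU : IsUnitaryOperator U) : adjointOp U * U = 1 :=
  LinearMap.ext fun φ => eq_of_stateInner_eq fun ψ => by
    rw [Module.End.mul_apply, ← stateInner_apply_left, hU.2, Module.End.one_apply]

theorem exists_smul_isUnitaryOperator {X : Module.End ℂ (StateSpace N d)} (hX : X ≠ 0) {c : ℂ}
    (hc : adjointOp X * X = c • 1) : ∃ s : ℂ, IsUnitaryOperator (s • X) := by
  have hinner (ψ φ : StateSpace N d) :
      stateInner (X ψ) (X φ) = starRingEnd ℂ c * stateInner ψ φ := by
    rw [stateInner_apply_left, ← Module.End.mul_apply, hc, LinearMap.smul_apply,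
      Module.End.one_apply, stateInner_eq_dotProduct_star, stateInner_eq_dotProduct_star, star_smul,
      dotProduct_smul, smul_eq_mul, mul_left_comm, starRingEnd_apply]
  obtain ⟨ψ, hψ⟩ : ∃ ψ, X ψ ≠ 0 := by
    by_contra! h
    exact hX (LinearMap.ext h)
  obtain ⟨a, ha, hψψ⟩ := exists_pos_stateInner_self_eq (ψ := ψ) (by rintro rfl; simp at hψ)
  obtain ⟨b, hb, hXψ⟩ := exists_pos_stateInner_self_eq hψ
  have hbc : (b : ℂ) = starRingEnd ℂ c * a := by rw [← hXψ, ← hψψ, hinner]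
  have hnorm : ‖(√(a / b) : ℂ)‖ ^ 2 = a / b := by
    rw [Complex.norm_real, Real.norm_eq_abs, sq_abs, Real.sq_sqrt (div_pos ha hb).le]
  refine ⟨√(a / b), isUnitaryOperator_of_isometry fun φ φ' => ?_⟩
  have hb₀ : (b : ℂ) ≠ 0 := Complex.ofReal_ne_zero.2 hb.ne'
  rw [LinearMap.smul_apply, LinearMap.smul_apply, stateInner_smul_smul, hinner,
    ← Complex.ofReal_pow, hnorm, Complex.ofReal_div, ← mul_assoc, div_mul_eq_mul_div,
    mul_comm (a : ℂ), ← hbc, div_self hb₀, one_mul]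

end Unitary

/-! ### Symplectic form -/

section SymplecticForm

variable {l R : Type*} [Fintype l] [DecidableEq l] [CommRing R]

/-- The standard symplectic form `ω(n, m) = n₂ · m₁ - n₁ · m₂`. -/
def symplecticForm (l R : Type*) [Fintype l] [DecidableEq l] [CommRing R] :
    LinearMap.BilinForm R (l ⊕ l → R) :=
  Matrix.toBilin' (J l R)

theorem symplecticForm_apply (n m : l ⊕ l → R) :
    symplecticForm l R n m =
      (n ∘ Sum.inr) ⬝ᵥ (m ∘ Sum.inl) - (n ∘ Sum.inl) ⬝ᵥ (m ∘ Sum.inr) := by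
  rw [symplecticForm, Matrix.toBilin'_apply', J, fromBlocks_mulVec,
    ← Sum.elim_comp_inl_inr n, sumElim_dotProduct_sumElim]
  simp only [zero_mulVec, neg_mulVec, one_mulVec, zero_add, dotProduct_neg, add_zero,
    Sum.elim_comp_inl_inr]
  ring

theorem isAlt_symplecticForm : (symplecticForm l R).IsAlt := fun n => by
  rw [symplecticForm_apply, dotProduct_comm, sub_self]

theorem symplecticForm_vecMul {A : Matrix (l ⊕ l) (l ⊕ l) R} (hA : A ∈ symplecticGroup l R)
    (n m : l ⊕ l → R) : symplecticForm l R (n ᵥ* A) (m ᵥ* A) = symplecticForm l R n m := by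
  rw [symplecticForm, Matrix.toBilin'_apply', Matrix.toBilin'_apply', ← mulVec_transpose A m,
    mulVec_mulVec, ← dotProduct_mulVec, mulVec_mulVec, ← Matrix.mul_assoc,
    SymplecticGroup.mem_iff.1 hA]

end SymplecticForm

/-! ### Weyl operators -/

section ShiftModulation

variable {N d : ℕ}

/-- The shift `ψ ↦ (y ↦ ψ (y + a))`. -/
def shiftOp (a : Fin d → ZMod N) : Module.End ℂ (StateSpace N d) :=
  LinearMap.funLeft ℂ ℂ (· + a)

theorem shiftOp_apply (a : Fin d → ZMod N) (ψ : StateSpace N d) (y : Fin d → ZMod N) :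
    shiftOp a ψ y = ψ (y + a) := rfl

theorem shiftOp_zero : shiftOp (0 : Fin d → ZMod N) = 1 :=
  LinearMap.ext fun ψ => funext fun y => congrArg ψ (add_zero y)

theorem shiftOp_mul (a a' : Fin d → ZMod N) : shiftOp a * shiftOp a' = shiftOp (a + a') :=
  LinearMap.ext fun ψ => funext fun y => congrArg ψ (add_assoc y a a')

variable [NeZero N]

/-- The modulation `ψ ↦ (y ↦ e_N(b · y) ψ(y))`. -/
noncomputable def modulationOp (b : Fin d → ZMod N) : Module.End ℂ (StateSpace N d) :=
  LinearMap.mulLeft ℂ fun y => ZMod.stdAddChar (b ⬝ᵥ y)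

theorem modulationOp_apply (b : Fin d → ZMod N) (ψ : StateSpace N d) (y : Fin d → ZMod N) :
    modulationOp b ψ y = ZMod.stdAddChar (b ⬝ᵥ y) * ψ y := rfl

theorem modulationOp_zero : modulationOp (0 : Fin d → ZMod N) = 1 :=
  LinearMap.ext fun ψ => funext fun y => by
    rw [modulationOp_apply, zero_dotProduct, AddChar.map_zero_eq_one, one_mul, Module.End.one_apply]

theorem modulationOp_mul (b b' : Fin d → ZMod N) :
    modulationOp b * modulationOp b' = modulationOp (b + b') :=
  LinearMap.ext fun ψ => funext fun y => by
    rw [Module.End.mul_apply, modulationOp_apply, modulationOp_apply, modulationOp_apply,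
      add_dotProduct, AddChar.map_add_eq_mul, mul_assoc]

theorem shiftOp_mul_modulationOp (a b : Fin d → ZMod N) :
    shiftOp a * modulationOp b =
      (ZMod.stdAddChar (b ⬝ᵥ a) : ℂ) • (modulationOp b * shiftOp a) :=
  LinearMap.ext fun ψ => funext fun y => by
    change ZMod.stdAddChar (b ⬝ᵥ (y + a)) * ψ (y + a) =
      ZMod.stdAddChar (b ⬝ᵥ a) * (ZMod.stdAddChar (b ⬝ᵥ y) * ψ (y + a))
    rw [dotProduct_add, AddChar.map_add_eq_mul, mul_comm (ZMod.stdAddChar _ : ℂ), mul_assoc]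

theorem eq_zero_of_stdAddChar_dotProduct {ι : Type*} [Fintype ι] {y : ι → ZMod N}
    (hy : ∀ b : ι → ZMod N, ZMod.stdAddChar (y ⬝ᵥ b) = (1 : ℂ)) : y = 0 := by
  classical
  ext i
  have hi := hy (Pi.single i 1)
  rw [dotProduct_single, mul_one] at hi
  exact ZMod.injective_stdAddChar (hi.trans (AddChar.map_zero_eq_one _).symm)

theorem sum_stdAddChar_dotProduct {ι : Type*} [Fintype ι] [DecidableEq ι] (b : ι → ZMod N) :
    ∑ y, (ZMod.stdAddChar (b ⬝ᵥ y) : ℂ) = if b = 0 then (N : ℂ) ^ Fintype.card ι else 0 := by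
  let χ : AddChar (ι → ZMod N) ℂ :=
    ZMod.stdAddChar.compAddMonoidHom (dotProductBilin (ZMod N) (ZMod N) b).toAddMonoidHom
  have hχ : χ = 0 ↔ b = 0 :=
    ⟨fun h => eq_zero_of_stdAddChar_dotProduct fun y => DFunLike.congr_fun h y, fun h =>
      DFunLike.ext _ _ fun y => by simp [χ, h]⟩
  have hsum := AddChar.sum_eq_ite χ
  simp only [hχ, Fintype.card_fun, ZMod.card, Nat.cast_pow] at hsum
  exact hsum

theorem modulationOp_single_zero (b : Fin d → ZMod N) (c : ℂ) :
    modulationOp b (Pi.single 0 c) = Pi.single 0 c := by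
  ext y
  rcases eq_or_ne y 0 with rfl | hy
  · rw [modulationOp_apply, dotProduct_zero, AddChar.map_zero_eq_one, one_mul]
  · rw [modulationOp_apply, Pi.single_eq_of_ne hy, mul_zero]

omit [NeZero N] in
theorem shiftOp_neg_single_zero (y : Fin d → ZMod N) (c : ℂ) :
    shiftOp (-y) (Pi.single 0 c) = Pi.single y c := by
  ext x
  simp only [shiftOp_apply, Pi.single_apply, add_neg_eq_zero]

theorem exists_eq_smul_one_of_commute {X : Module.End ℂ (StateSpace N d)}
    (hshift : ∀ a, Commute X (shiftOp a)) (hmod : ∀ b, Commute X (modulationOp b)) :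
    ∃ c : ℂ, X = c • 1 := by
  let c := X (Pi.single 0 1) 0
  have hzero : X (Pi.single 0 1) = c • Pi.single 0 1 := by
    ext y
    rcases eq_or_ne y 0 with rfl | hy
    · simp [c]
    · have hXy : X (Pi.single 0 1) y = 0 := by
        by_contra hne
        refine hy (eq_zero_of_stdAddChar_dotProduct fun b => mul_right_cancel₀ hne ?_)
        have hb := congrFun (LinearMap.congr_fun (hmod b) (Pi.single 0 1)) y
        rw [Module.End.mul_apply, modulationOp_single_zero] at hb
        rw [dotProduct_comm, one_mul]
        exact hb.symm
      rw [hXy, Pi.smul_apply, Pi.single_eq_of_ne hy, smul_zero]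
  refine ⟨c, LinearMap.pi_ext' fun y => LinearMap.ext_ring ?_⟩
  change X (Pi.single y 1) = c • Pi.single y 1
  calc X (Pi.single y 1) = shiftOp (-y) (X (Pi.single 0 1)) := by
        rw [← shiftOp_neg_single_zero]
        exact LinearMap.congr_fun (hshift (-y)) _
    _ = c • Pi.single y 1 := by rw [hzero, map_smul, shiftOp_neg_single_zero]

theorem trace_modulationOp_mul_shiftOp (a b : Fin d → ZMod N) :
    LinearMap.trace ℂ (StateSpace N d) (modulationOp b * shiftOp a) =
      if a = 0 ∧ b = 0 then (N : ℂ) ^ d else 0 := by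
  have hdiag (y : Fin d → ZMod N) : LinearMap.toMatrix' (modulationOp b * shiftOp a) y y =
      if a = 0 then ZMod.stdAddChar (b ⬝ᵥ y) else 0 := by
    simp [LinearMap.toMatrix'_apply, modulationOp_apply, shiftOp_apply, Pi.single_apply]
  rw [LinearMap.trace_eq_matrix_trace ℂ (Pi.basisFun ℂ _), LinearMap.toMatrix_eq_toMatrix',
    Matrix.trace]
  simp only [Matrix.diag_apply, hdiag]
  by_cases ha : a = 0
  · simpa [ha] using sum_stdAddChar_dotProduct b
  · simp [ha]

end ShiftModulation

section WeylPhase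

variable {N M : ℕ} [NeZero N]

/-- `κ` is the character `s ↦ (-1) ^ (N s) e_{2N}(s)` of the phases of the operators `T_N(n)`,
which is well defined modulo `M = N` for odd `N` and `M = 2N` for even `N`. -/
def IsWeylPhase (N : ℕ) [NeZero N] {M : ℕ} (κ : AddChar (ZMod M) ℂ) : Prop :=
  ∀ s : ℤ, κ s = (-1) ^ ((N : ℤ) * s) * ZMod.stdAddChar (s : ZMod (2 * N))

theorem isWeylPhase_mulShift_stdAddChar [NeZero M] {t : ℕ} (ht : t * (2 * N) = M * (N ^ 2 + 1)) :
    IsWeylPhase N ((ZMod.stdAddChar (N := M)).mulShift (t : ZMod M)) := by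
  intro s
  have hN : (N : ℂ) ≠ 0 := Nat.cast_ne_zero.2 (NeZero.ne N)
  have hM : (M : ℂ) ≠ 0 := Nat.cast_ne_zero.2 (NeZero.ne M)
  have ht' : (t : ℂ) * (2 * N) = M * (N ^ 2 + 1) := by exact_mod_cast ht
  have hts : (t : ZMod M) * (s : ZMod M) = ((t * s : ℤ) : ZMod M) := by push_cast; rfl
  rw [AddChar.mulShift_apply, hts, ZMod.stdAddChar_coe, ZMod.stdAddChar_coe,
    ← Complex.exp_pi_mul_I, ← Complex.exp_int_mul, ← Complex.exp_add]
  congr 1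
  push_cast
  field_simp
  linear_combination (s : ℂ) * ht'

theorem exists_isWeylPhase_of_odd (hN : Odd N) : ∃ κ : AddChar (ZMod N) ℂ, IsWeylPhase N κ := by
  obtain ⟨t, ht⟩ : Even (N ^ 2 + 1) := (hN.pow).add_odd odd_one
  exact ⟨_, isWeylPhase_mulShift_stdAddChar (t := t) (by rw [ht]; ring)⟩

theorem exists_isWeylPhase_two_mul (N : ℕ) [NeZero N] :
    ∃ κ : AddChar (ZMod (2 * N)) ℂ, IsWeylPhase N κ :=
  ⟨_, isWeylPhase_mulShift_stdAddChar (t := N ^ 2 + 1) (mul_comm _ _)⟩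

namespace IsWeylPhase

variable {κ : AddChar (ZMod M) ℂ} (hκ : IsWeylPhase N κ)

include hκ

theorem apply_two_mul (h : N ∣ M) (x : ZMod M) :
    κ (2 * x) = ZMod.stdAddChar (ZMod.castHom h (ZMod N) x) := by
  obtain ⟨s, rfl⟩ := ZMod.intCast_surjective x
  have hN : (N : ℂ) ≠ 0 := Nat.cast_ne_zero.2 (NeZero.ne N)
  have hs := hκ (2 * s)
  have heven : Even ((N : ℤ) * (2 * s)) := (even_two_mul s).mul_left _
  rw [heven.neg_one_zpow, one_mul, ZMod.stdAddChar_coe] at hs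
  push_cast at hs
  rw [hs, map_intCast, ZMod.stdAddChar_coe]
  congr 1
  field_simp

theorem apply_mul_eq_one (h : N ∣ M) {x y : ZMod M} (hx : ZMod.castHom h (ZMod N) x = 0)
    (hy : ZMod.castHom h (ZMod N) y = 0) : κ (x * y) = 1 := by
  obtain ⟨s, rfl⟩ := ZMod.intCast_surjective x
  obtain ⟨t, rfl⟩ := ZMod.intCast_surjective y
  rw [map_intCast, ZMod.intCast_zmod_eq_zero_iff_dvd] at hx hy
  obtain ⟨a, rfl⟩ := hx
  obtain ⟨b, rfl⟩ := hy
  have hN : (N : ℂ) ≠ 0 := Nat.cast_ne_zero.2 (NeZero.ne N)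
  have heven : Even ((N : ℤ) * (N * a * (N * b)) + N * (a * b)) := by
    simp only [Int.even_add, Int.even_mul]
    tauto
  calc κ (((N * a : ℤ) : ZMod M) * ((N * b : ℤ) : ZMod M))
      = (-1) ^ ((N : ℤ) * (N * a * (N * b)) + N * (a * b)) := by
        rw [← Int.cast_mul, hκ, ZMod.stdAddChar_coe, zpow_add₀ (by norm_num),
          ← Complex.exp_pi_mul_I, ← Complex.exp_int_mul _ (N * (a * b) : ℤ)]
        congr 2
        push_cast
        field_simp
    _ = 1 := heven.neg_one_zpow

end IsWeylPhase

end WeylPhase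

section WeylOp

variable {N M d : ℕ} [NeZero N]

/-- Coordinatewise reduction modulo `N` of vectors over `ℤ/Mℤ`. -/
def reduceMod (ι : Type*) (h : N ∣ M) : (ι → ZMod M) →+* (ι → ZMod N) :=
  (ZMod.castHom h (ZMod N)).compLeft ι

omit [NeZero N] in
theorem reduceMod_apply {ι : Type*} (h : N ∣ M) (v : ι → ZMod M) (i : ι) :
    reduceMod ι h v i = ZMod.castHom h (ZMod N) (v i) := rfl

omit [NeZero N] in
theorem reduceMod_surjective (ι : Type*) (h : N ∣ M) : Function.Surjective (reduceMod ι h) :=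
  (ZMod.castHom_surjective h).comp_left

omit [NeZero N] in
theorem reduceMod_dotProduct {ι : Type*} [Fintype ι] (h : N ∣ M) (v w : ι → ZMod M) :
    ZMod.castHom h (ZMod N) (v ⬝ᵥ w) = reduceMod ι h v ⬝ᵥ reduceMod ι h w :=
  RingHom.map_dotProduct _ v w

/-- The Weyl operator `ψ ↦ (y ↦ κ(n₁ · n₂) e_N(n₂ · y) ψ(y + n₁))` of `n = (n₁, n₂)`, where
`n₁`, `n₂` are reduced modulo `N`. For the character `κ` of `IsWeylPhase` it is the operator
`T_N(n)`, regarded as a function of `n` modulo `M`. -/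
noncomputable def weylOp (κ : AddChar (ZMod M) ℂ) (h : N ∣ M) (n : Fin d ⊕ Fin d → ZMod M) :
    Module.End ℂ (StateSpace N d) :=
  κ ((n ∘ Sum.inl) ⬝ᵥ (n ∘ Sum.inr)) •
    (modulationOp (reduceMod _ h (n ∘ Sum.inr)) * shiftOp (reduceMod _ h (n ∘ Sum.inl)))

variable {κ : AddChar (ZMod M) ℂ} {h : N ∣ M}

theorem weylOp_apply (n : Fin d ⊕ Fin d → ZMod M) (ψ : StateSpace N d) (y : Fin d → ZMod N) :
    weylOp κ h n ψ y = κ ((n ∘ Sum.inl) ⬝ᵥ (n ∘ Sum.inr)) *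
      (ZMod.stdAddChar (reduceMod _ h (n ∘ Sum.inr) ⬝ᵥ y) *
        ψ (y + reduceMod _ h (n ∘ Sum.inl))) := rfl

theorem weylOp_elim_left (a : Fin d → ZMod M) :
    weylOp κ h (Sum.elim a 0) = shiftOp (reduceMod (Fin d) h a) := by
  rw [weylOp, Sum.elim_comp_inl, Sum.elim_comp_inr, dotProduct_zero, AddChar.map_zero_eq_one,
    one_smul, map_zero, modulationOp_zero, one_mul]

theorem weylOp_elim_right (b : Fin d → ZMod M) :
    weylOp κ h (Sum.elim 0 b) = modulationOp (reduceMod _ h b) := by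
  rw [weylOp, Sum.elim_comp_inl, Sum.elim_comp_inr, zero_dotProduct, AddChar.map_zero_eq_one,
    one_smul, map_zero, shiftOp_zero, mul_one]

theorem weylOp_zero : weylOp κ h (0 : Fin d ⊕ Fin d → ZMod M) = 1 := by
  rw [← Sum.elim_zero_zero, weylOp_elim_left, map_zero, shiftOp_zero]

theorem weylOp_mul (hκ : IsWeylPhase N κ) (n m : Fin d ⊕ Fin d → ZMod M) :
    weylOp κ h n * weylOp κ h m =
      κ (-symplecticForm (Fin d) (ZMod M) n m) • weylOp κ h (n + m) := by
  have hphase : κ ((n ∘ Sum.inl) ⬝ᵥ (n ∘ Sum.inr)) * κ ((m ∘ Sum.inl) ⬝ᵥ (m ∘ Sum.inr)) *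
      ZMod.stdAddChar (reduceMod _ h (m ∘ Sum.inr) ⬝ᵥ reduceMod _ h (n ∘ Sum.inl)) =
      κ (-symplecticForm (Fin d) (ZMod M) n m) *
        κ (((n + m) ∘ Sum.inl) ⬝ᵥ ((n + m) ∘ Sum.inr)) := by
    rw [← reduceMod_dotProduct, ← hκ.apply_two_mul, ← AddChar.map_add_eq_mul,
      ← AddChar.map_add_eq_mul, ← AddChar.map_add_eq_mul, symplecticForm_apply,
      Pi.add_comp, Pi.add_comp, add_dotProduct, dotProduct_add, dotProduct_add,
      dotProduct_comm (m ∘ Sum.inr), dotProduct_comm (n ∘ Sum.inr)]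
    ring_nf
  calc weylOp κ h n * weylOp κ h m
      = (κ ((n ∘ Sum.inl) ⬝ᵥ (n ∘ Sum.inr)) * κ ((m ∘ Sum.inl) ⬝ᵥ (m ∘ Sum.inr)) *
          ZMod.stdAddChar (reduceMod _ h (m ∘ Sum.inr) ⬝ᵥ reduceMod _ h (n ∘ Sum.inl))) •
        (modulationOp (reduceMod _ h ((n + m) ∘ Sum.inr)) *
          shiftOp (reduceMod _ h ((n + m) ∘ Sum.inl))) := by
        rw [weylOp, weylOp, smul_mul_smul_comm, mul_smul, mul_assoc (modulationOp _),
          ← mul_assoc (shiftOp _), shiftOp_mul_modulationOp, smul_mul_assoc, mul_smul_comm,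
          mul_assoc (modulationOp _), shiftOp_mul, ← mul_assoc, modulationOp_mul, Pi.add_comp,
          Pi.add_comp, map_add, map_add, smul_smul, smul_smul, mul_assoc]
    _ = κ (-symplecticForm (Fin d) (ZMod M) n m) • weylOp κ h (n + m) := by
        rw [hphase, mul_smul, weylOp]

theorem weylOp_mul_neg (hκ : IsWeylPhase N κ) (n : Fin d ⊕ Fin d → ZMod M) :
    weylOp κ h n * weylOp κ h (-n) = 1 := by
  rw [weylOp_mul hκ, (symplecticForm (Fin d) (ZMod M) n).map_neg,
    isAlt_symplecticForm.self_eq_zero, neg_zero, neg_zero, AddChar.map_zero_eq_one, one_smul,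
    add_neg_cancel, weylOp_zero]

theorem isUnitaryOperator_shiftOp (a : Fin d → ZMod N) : IsUnitaryOperator (shiftOp a) :=
  isUnitaryOperator_of_isometry fun ψ φ => congrArg _ <|
    Equiv.sum_comp (Equiv.addRight a) fun x => ψ x * (starRingEnd ℂ) (φ x)

theorem isUnitaryOperator_modulationOp (b : Fin d → ZMod N) :
    IsUnitaryOperator (modulationOp b) :=
  isUnitaryOperator_of_isometry fun ψ φ => congrArg _ <| Finset.sum_congr rfl fun y _ => by
    rw [modulationOp_apply, modulationOp_apply, map_mul, mul_mul_mul_comm, Complex.mul_conj',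
      AddChar.norm_apply, Complex.ofReal_one, one_pow, one_mul]

theorem isUnitaryOperator_weylOp [NeZero M] (n : Fin d ⊕ Fin d → ZMod M) :
    IsUnitaryOperator (weylOp κ h n) :=
  ((isUnitaryOperator_modulationOp _).mul (isUnitaryOperator_shiftOp _)).smul (κ.norm_apply _)

theorem adjointOp_weylOp [NeZero M] (hκ : IsWeylPhase N κ) (n : Fin d ⊕ Fin d → ZMod M) :
    adjointOp (weylOp κ h n) = weylOp κ h (-n) :=
  left_inv_eq_right_inv (isUnitaryOperator_weylOp n).adjointOp_mul_self (weylOp_mul_neg hκ n)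

theorem trace_weylOp (hκ : IsWeylPhase N κ) (n : Fin d ⊕ Fin d → ZMod M) :
    LinearMap.trace ℂ (StateSpace N d) (weylOp κ h n) =
      if reduceMod _ h n = 0 then (N : ℂ) ^ d else 0 := by
  have hn : reduceMod _ h n = 0 ↔
      reduceMod _ h (n ∘ Sum.inl) = 0 ∧ reduceMod _ h (n ∘ Sum.inr) = 0 := by
    simp only [funext_iff, Sum.forall]
    rfl
  rw [weylOp, map_smul, trace_modulationOp_mul_shiftOp]
  simp only [← hn]
  split_ifs with h₀
  · have hκ_one : κ ((n ∘ Sum.inl) ⬝ᵥ (n ∘ Sum.inr)) = 1 := by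
      exact Finset.sum_induction _ (κ · = 1)
        (fun x y hx hy => by rw [AddChar.map_add_eq_mul, hx, hy, one_mul]) κ.map_zero_eq_one
        fun i _ => hκ.apply_mul_eq_one h (congrFun h₀ (Sum.inl i)) (congrFun h₀ (Sum.inr i))
    rw [hκ_one, one_smul]
  · exact smul_zero _

theorem exists_eq_smul_one_of_commute_weylOp {X : Module.End ℂ (StateSpace N d)}
    (hX : ∀ n, Commute X (weylOp κ h n)) : ∃ c : ℂ, X = c • 1 := by
  refine exists_eq_smul_one_of_commute (fun a => ?_) fun b => ?_
  · obtain ⟨a, rfl⟩ := reduceMod_surjective _ h a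
    simpa only [weylOp_elim_left] using hX (Sum.elim a 0)
  · obtain ⟨b, rfl⟩ := reduceMod_surjective _ h b
    simpa only [weylOp_elim_right] using hX (Sum.elim 0 b)

theorem twistedOp_eq_weylOp (hκ : IsWeylPhase N κ) (h : N ∣ M) (n : Fin d ⊕ Fin d → ℤ) :
    twistedOp N n = weylOp κ h fun i => (n i : ZMod M) := by
  have hdot : ((fun i => (n i : ZMod M)) ∘ Sum.inl) ⬝ᵥ ((fun i => (n i : ZMod M)) ∘ Sum.inr) =
      (((n ∘ Sum.inl) ⬝ᵥ (n ∘ Sum.inr) : ℤ) : ZMod M) := by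
    simp [dotProduct]
  have hred (j : Fin d → Fin d ⊕ Fin d) :
      reduceMod _ h ((fun i => (n i : ZMod M)) ∘ j) = fun i => (n (j i) : ZMod N) :=
    funext fun i => map_intCast (ZMod.castHom h (ZMod N)) (n (j i))
  refine LinearMap.ext fun ψ => funext fun y => ?_
  rw [weylOp_apply, hdot, hκ, hred, hred, mul_assoc]
  exact congrArg ((-1 : ℂ) ^ ((N : ℤ) * (n ∘ Sum.inl) ⬝ᵥ (n ∘ Sum.inr)) * ·) (mul_assoc _ _ _)

end WeylOp

/-! ### Intertwining operators -/

section Intertwines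

variable {N M d : ℕ} [NeZero N] {κ : AddChar (ZMod M) ℂ} {h : N ∣ M}
  {A B : Matrix (Fin d ⊕ Fin d) (Fin d ⊕ Fin d) (ZMod M)} {X U V : Module.End ℂ (StateSpace N d)}

/-- `X` satisfies the relation `X T(nA) = T(n) X`, where `T(n)` are the Weyl operators. -/
def Intertwines (κ : AddChar (ZMod M) ℂ) (h : N ∣ M)
    (A : Matrix (Fin d ⊕ Fin d) (Fin d ⊕ Fin d) (ZMod M)) (X : Module.End ℂ (StateSpace N d)) :
    Prop :=
  ∀ n, SemiconjBy X (weylOp κ h (n ᵥ* A)) (weylOp κ h n)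

theorem isPropagator_iff (hκ : IsWeylPhase N κ) (h : N ∣ M) :
    IsPropagator N A U ↔ IsUnitaryOperator U ∧ Intertwines κ h A U := by
  refine and_congr_right fun _ => ⟨fun hU n => ?_, fun hU n m hnm => ?_⟩
  · obtain ⟨n, rfl⟩ := ZMod.intCast_surjective.comp_left n
    obtain ⟨m, hm⟩ := ZMod.intCast_surjective.comp_left ((fun i => (n i : ZMod M)) ᵥ* A)
    have hnm := hU n m hm
    rw [twistedOp_eq_weylOp hκ h, twistedOp_eq_weylOp hκ h] at hnm
    exact hm ▸ hnm
  · rw [twistedOp_eq_weylOp hκ h, twistedOp_eq_weylOp hκ h, hnm, hU]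

theorem intertwines_parityOp : Intertwines κ h (-1) (parityOp ℂ (Fin d → ZMod N)) := fun n => by
  refine LinearMap.ext fun ψ => funext fun y => ?_
  rw [vecMul_neg, vecMul_one, Module.End.mul_apply, Module.End.mul_apply, parityOp_apply,
    weylOp_apply, weylOp_apply, parityOp_apply]
  change κ ((-(n ∘ Sum.inl)) ⬝ᵥ (-(n ∘ Sum.inr))) *
    (ZMod.stdAddChar (reduceMod _ h (-(n ∘ Sum.inr)) ⬝ᵥ -y) *
      ψ (-y + reduceMod _ h (-(n ∘ Sum.inl)))) = _
  rw [map_neg, map_neg, neg_dotProduct_neg, neg_dotProduct_neg, neg_add]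

namespace Intertwines

theorem mul (hU : Intertwines κ h A U) (hV : Intertwines κ h B V) :
    Intertwines κ h (A * B) (U * V) := fun n =>
  vecMul_vecMul n A B ▸ (hU n).mul_left (hV (n ᵥ* A))

theorem smul (hU : Intertwines κ h A U) (c : ℂ) : Intertwines κ h A (c • U) := fun n => by
  rw [SemiconjBy, smul_mul_assoc, hU n, mul_smul_comm]

theorem exists_eq_smul (hU : Intertwines κ h A U) (hV : Intertwines κ h A V) (hV' : IsUnit V) :
    ∃ c : ℂ, U = c • V := by
  obtain ⟨V, rfl⟩ := hV'
  obtain ⟨c, hc⟩ := exists_eq_smul_one_of_commute_weylOp fun n =>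
    (hU n).mul_left (hV n).units_inv_symm_left
  exact ⟨c, by rw [Units.mul_inv_eq_iff_eq_mul] at hc; rw [hc, smul_mul_assoc, one_mul]⟩

theorem adjointOp_mul_self [NeZero M] (hκ : IsWeylPhase N κ) (hX : Intertwines κ h A X)
    (hA : IsUnit A) : ∃ c : ℂ, adjointOp X * X = c • 1 := by
  have hadj (n : Fin d ⊕ Fin d → ZMod M) :
      SemiconjBy (adjointOp X) (weylOp κ h n) (weylOp κ h (n ᵥ* A)) := by
    have hX' := congrArg adjointOp (hX (-n))
    rw [adjointOp_mul, adjointOp_mul, adjointOp_weylOp hκ, adjointOp_weylOp hκ, neg_vecMul,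
      neg_neg, neg_neg] at hX'
    exact hX'.symm
  refine exists_eq_smul_one_of_commute_weylOp (κ := κ) (h := h) fun n => ?_
  obtain ⟨n, rfl⟩ := (vecMul_surjective_iff_isUnit.2 hA) n
  exact (hadj n).mul_left (hX n)

end Intertwines

variable [NeZero M]

theorem intertwines_sum_weylOp (hκ : IsWeylPhase N κ)
    (hA : A ∈ symplecticGroup (Fin d) (ZMod M)) (Y : Module.End ℂ (StateSpace N d)) :
    Intertwines κ h A (∑ k, weylOp κ h k * Y * weylOp κ h (-k ᵥ* A)) := fun n => by
  refine .symm (mul_sum_mul_mul_neg (β := fun n k => κ (-symplecticForm (Fin d) (ZMod M) n k))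
    (S := weylOp κ h) (T := fun n => weylOp κ h (n ᵥ* A)) (weylOp_mul hκ) (fun n k => ?_)
    (fun n k => ?_) Y n)
  · rw [weylOp_mul hκ, symplecticForm_vecMul hA, add_vecMul]
  · rw [LinearMap.map_neg₂, LinearMap.map_add₂, isAlt_symplecticForm.self_eq_zero, zero_add,
      neg_neg, isAlt_symplecticForm.neg_eq]

theorem exists_intertwines_ne_zero (hκ : IsWeylPhase N κ)
    (hA : A ∈ symplecticGroup (Fin d) (ZMod M)) : ∃ X, Intertwines κ h A X ∧ X ≠ 0 := by
  by_contra! hzero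
  have hsum := sum_linearMap_trace_mul_trace_eq_zero fun Y =>
    hzero _ (intertwines_sum_weylOp (h := h) hκ hA Y)
  have hterm (k : Fin d ⊕ Fin d → ZMod M) :
      LinearMap.trace ℂ _ (weylOp κ h k) * LinearMap.trace ℂ _ (weylOp κ h (-k ᵥ* A)) =
        if reduceMod _ h k = 0 then (N : ℂ) ^ d * (N : ℂ) ^ d else 0 := by
    rw [trace_weylOp hκ, trace_weylOp hκ]
    by_cases hk : reduceMod _ h k = 0
    · have hkA : reduceMod _ h (-k ᵥ* A) = 0 := by
        ext i
        rw [reduceMod_apply, RingHom.map_vecMul]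
        change ((reduceMod _ h (-k)) ᵥ* _) i = 0
        rw [map_neg, hk, neg_zero, zero_vecMul, Pi.zero_apply]
      rw [if_pos hk, if_pos hk, if_pos hkA]
    · rw [if_neg hk, if_neg hk, zero_mul]
  have hN : (N : ℂ) ^ d * (N : ℂ) ^ d ≠ 0 := by
    have := NeZero.ne (N : ℂ)
    positivity
  simp only [hterm, ← Finset.sum_filter, Finset.sum_const, smul_eq_zero, hN, or_false,
    Finset.card_eq_zero] at hsum
  exact Finset.eq_empty_iff_forall_notMem.1 hsum 0
    (Finset.mem_filter.2 ⟨Finset.mem_univ _, map_zero _⟩)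

theorem exists_isPropagator (hκ : IsWeylPhase N κ) (h : N ∣ M)
    (hA : A ∈ symplecticGroup (Fin d) (ZMod M)) : ∃ U, IsPropagator N A U := by
  obtain ⟨X, hX, hX₀⟩ := exists_intertwines_ne_zero (h := h) hκ hA
  obtain ⟨c, hc⟩ := hX.adjointOp_mul_self hκ
    ((isUnit_iff_isUnit_det A).2 (SymplecticGroup.symplectic_det hA))
  obtain ⟨s, hs⟩ := exists_smul_isUnitaryOperator hX₀ hc
  exact ⟨s • X, (isPropagator_iff hκ h).2 ⟨hs, hX.smul s⟩⟩

omit [NeZero M] in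
theorem IsPropagator.exists_circle_smul (hκ : IsWeylPhase N κ) (h : N ∣ M)
    (hU : IsPropagator N A U) (hV : IsPropagator N A V) : ∃ c : Circle, U = (c : ℂ) • V := by
  rw [isPropagator_iff hκ h] at hU hV
  obtain ⟨c, rfl⟩ := hU.2.exists_eq_smul hV.2 hV.1.isUnit
  exact ⟨⟨c, mem_sphere_zero_iff_norm.2 (hV.1.norm_eq_one_of_smul hU.1)⟩, rfl⟩

end Intertwines

/-! ### Fixed spaces of Weyl operators -/

section FixedSpace

variable {N M d : ℕ} [NeZero N] {κ : AddChar (ZMod M) ℂ} {h : N ∣ M} {q r m : ℕ}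

/-- The space of the states fixed by the Weyl operators of all `n ∈ S`. -/
noncomputable def weylFixedSpace (κ : AddChar (ZMod M) ℂ) (h : N ∣ M)
    (S : Set (Fin d ⊕ Fin d → ZMod M)) : Submodule ℂ (StateSpace N d) :=
  ⨅ n ∈ S, (weylOp κ h n).eigenspace 1

theorem mem_weylFixedSpace {S : Set (Fin d ⊕ Fin d → ZMod M)} {ψ : StateSpace N d} :
    ψ ∈ weylFixedSpace κ h S ↔ ∀ n ∈ S, weylOp κ h n ψ = ψ := by
  simp only [weylFixedSpace, Submodule.mem_iInf, Module.End.mem_eigenspace_iff, one_smul]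

theorem Intertwines.apply_mem_weylFixedSpace
    {A : Matrix (Fin d ⊕ Fin d) (Fin d ⊕ Fin d) (ZMod M)} {U : Module.End ℂ (StateSpace N d)}
    (hU : Intertwines κ h A U) {S : Set (Fin d ⊕ Fin d → ZMod M)} (hS : ∀ n ∈ S, n ᵥ* A ∈ S)
    {ψ : StateSpace N d} (hψ : ψ ∈ weylFixedSpace κ h S) : U ψ ∈ weylFixedSpace κ h S := by
  rw [mem_weylFixedSpace] at hψ ⊢
  intro n hn
  calc weylOp κ h n (U ψ) = U (weylOp κ h (n ᵥ* A) ψ) := (LinearMap.congr_fun (hU n) ψ).symm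
    _ = U ψ := by rw [hψ _ (hS n hn)]

/-- The vectors `n = (n₁, n₂)` with `n₁` divisible by `s` and `n₂` divisible by `t` whose Weyl
operator has the phase `κ(n₁ · n₂) = 1`. -/
def phaseFreeSet (d : ℕ) (κ : AddChar (ZMod M) ℂ) (s t : ℕ) : Set (Fin d ⊕ Fin d → ZMod M) :=
  {n | ∃ a b : Fin d → ZMod M, n = Sum.elim (s • a) (t • b) ∧ κ ((s • a) ⬝ᵥ (t • b)) = 1}

omit [NeZero N] in
theorem nsmul_eq_zero_iff_exists_eq_nsmul {ι : Type*} {k : ℕ} [NeZero q] (hN : N = q * k)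
    {z : ι → ZMod N} : q • z = 0 ↔ ∃ a, z = k • a := by
  constructor
  · intro hz
    have hdvd (i : ι) : ∃ a : ZMod N, z i = k • a := by
      obtain ⟨j, hj⟩ := ZMod.intCast_surjective (z i)
      have hqj : ((q * j : ℤ) : ZMod N) = 0 := by
        rw [Int.cast_mul, hj, Int.cast_natCast, ← nsmul_eq_mul]
        exact congrFun hz i
      rw [ZMod.intCast_zmod_eq_zero_iff_dvd, hN, Nat.cast_mul] at hqj
      obtain ⟨t, rfl⟩ := Int.dvd_of_mul_dvd_mul_left (Nat.cast_ne_zero.2 (NeZero.ne q)) hqj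
      exact ⟨t, by rw [← hj, Int.cast_mul, Int.cast_natCast, nsmul_eq_mul]⟩
    choose a ha using hdvd
    exact ⟨a, funext ha⟩
  · rintro ⟨a, rfl⟩
    rw [smul_smul, ← hN]
    exact ZModModule.char_nsmul_eq_zero N a

theorem weylOp_apply_of_mem_cosetSpace (hN : N = q * r * m) {n : Fin d ⊕ Fin d → ZMod M}
    (hn : n ∈ phaseFreeSet d κ (r * m) (q * m)) {ψ : StateSpace N d}
    (hψ : ψ ∈ cosetSpace ℂ (Fin d → ZMod N) q m) : weylOp κ h n ψ = ψ := by
  obtain ⟨a, b, rfl, hab⟩ := hn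
  ext y
  have hshift : q • reduceMod _ h ((r * m) • a) = 0 := by
    rw [← map_nsmul, smul_smul, ← mul_assoc, ← hN, map_nsmul]
    exact ZModModule.char_nsmul_eq_zero N _
  rw [weylOp_apply, Sum.elim_comp_inl, Sum.elim_comp_inr, hab, one_mul, hψ.2 y _ hshift, map_nsmul,
    smul_dotProduct, ← dotProduct_smul]
  by_cases hy : (q * m) • y = 0
  · rw [hy, dotProduct_zero, AddChar.map_zero_eq_one, one_mul]
  · rw [hψ.1 y hy, mul_zero]

theorem weylFixedSpace_phaseFreeSet (hN : N = q * r * m) :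
    weylFixedSpace κ h (phaseFreeSet d κ (r * m) (q * m)) =
      cosetSpace ℂ (Fin d → ZMod N) q m := by
  have : NeZero q := ⟨by rintro rfl; exact NeZero.ne N (by rw [hN, zero_mul, zero_mul])⟩
  refine le_antisymm (fun ψ hψ => ?_) fun ψ hψ =>
    mem_weylFixedSpace.2 fun n hn => weylOp_apply_of_mem_cosetSpace hN hn hψ
  rw [mem_weylFixedSpace] at hψ
  refine ⟨fun y hy => ?_, fun y z hz => ?_⟩
  · by_contra hψy
    refine hy (eq_zero_of_stdAddChar_dotProduct fun b => mul_right_cancel₀ hψy ?_)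
    obtain ⟨b, rfl⟩ := reduceMod_surjective _ h b
    have hb := congrFun (hψ (Sum.elim 0 ((q * m) • b)) ⟨0, b, by rw [smul_zero], by simp⟩) y
    rw [weylOp_elim_right, modulationOp_apply, map_nsmul, dotProduct_comm, dotProduct_smul,
      ← smul_dotProduct] at hb
    rw [hb, one_mul]
  · rw [mul_assoc] at hN
    obtain ⟨a, rfl⟩ := (nsmul_eq_zero_iff_exists_eq_nsmul hN).1 hz
    obtain ⟨a, rfl⟩ := reduceMod_surjective _ h a
    have ha := congrFun (hψ (Sum.elim ((r * m) • a) 0) ⟨a, 0, by rw [smul_zero], by simp⟩) y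
    rwa [weylOp_elim_left, shiftOp_apply, map_nsmul] at ha

end FixedSpace

/-! ### Representations -/

section Representation

variable {N M d : ℕ} [NeZero N] [NeZero M] {κ : AddChar (ZMod M) ℂ} {h : N ∣ M} {q r m : ℕ}

omit [NeZero M] in
theorem Intertwines.commute_parityOp {A : Matrix (Fin d ⊕ Fin d) (Fin d ⊕ Fin d) (ZMod M)}
    {U : Module.End ℂ (StateSpace N d)} (hU : Intertwines κ h A U) (hU' : IsUnit U)
    (hN : N = q * r * m) (hm : Odd m)
    (hA : ∀ n ∈ phaseFreeSet d κ (r * m) (q * m), n ᵥ* A ∈ phaseFreeSet d κ (r * m) (q * m)) :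
    Commute (parityOp ℂ (Fin d → ZMod N)) U := by
  obtain ⟨c, hc⟩ : ∃ c : ℂ, parityOp ℂ _ * U = c • (U * parityOp ℂ _) := by
    have hPU := intertwines_parityOp.mul hU
    rw [neg_one_mul, ← mul_neg_one] at hPU
    exact hPU.exists_eq_smul (hU.mul intertwines_parityOp) (hU'.mul isUnit_parityOp)
  refine commute_of_mul_eq_smul_mul (W := cosetSpace ℂ (Fin d → ZMod N) q m) parityOp_mul_self
    ((Module.End.isUnit_iff U).1 hU').1 (fun ψ hψ => ?_) hc ?_
  · rw [← weylFixedSpace_phaseFreeSet (κ := κ) (h := h) hN] at hψ ⊢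
    exact hU.apply_mem_weylFixedSpace hA hψ
  · rw [finrank_cosetSpace_inf_even_eq_finrank_odd_add_one (by simp) hm]
    exact Nat.lt_succ_self _

theorem exists_representation_isPropagator {G : Type*} [Group G] [Finite G]
    (hκ : IsWeylPhase N κ) (h : N ∣ M) (hN : N = q * r * m) (hm : Odd m)
    (f : G →* symplecticGroup (Fin d) (ZMod M))
    (hf : ∀ g, ∀ n ∈ phaseFreeSet d κ (r * m) (q * m),
      n ᵥ* (f g).1 ∈ phaseFreeSet d κ (r * m) (q * m)) :
    ∃ ρ : Representation ℂ G (StateSpace N d), ∀ g, IsPropagator N (f g).1 (ρ g) := by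
  choose U hU using fun g => exists_isPropagator hκ h (f g).2
  have hint (g : G) : Intertwines κ h (f g).1 (U g) := ((isPropagator_iff hκ h).1 (hU g)).2
  have hmul (g k : G) : ∃ c : ℂ, U g * U k = c • U (g * k) := by
    have hgk := (hint g).mul (hint k)
    rw [← Submonoid.coe_mul, ← map_mul] at hgk
    exact hgk.exists_eq_smul (hint (g * k)) (hU (g * k)).1.isUnit
  have hparity (g : G) := (hint g).commute_parityOp (hU g).1.isUnit hN hm (hf g)
  have hpreserve (g : G) (ε : ℂ) : ∀ ψ ∈ cosetSpace ℂ (Fin d → ZMod N) q m ⊓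
      (parityOp ℂ _).eigenspace ε, U g ψ ∈ cosetSpace ℂ (Fin d → ZMod N) q m ⊓
      (parityOp ℂ _).eigenspace ε := fun ψ hψ => by
    refine ⟨?_, Module.End.mapsTo_genEigenspace_of_comm (hparity g) ε 1 hψ.2⟩
    rw [← weylFixedSpace_phaseFreeSet (κ := κ) (h := h) hN] at hψ ⊢
    exact (hint g).apply_mem_weylFixedSpace (hf g) hψ.1
  obtain ⟨c, ρ, hρ⟩ := exists_monoidHom_smul_of_finrank_eq_add_one (fun g => (hU g).1.1.1) hmul
    (fun g => hpreserve g 1) (fun g => hpreserve g (-1))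
    (finrank_cosetSpace_inf_even_eq_finrank_odd_add_one (by simp) hm)
  refine ⟨ρ, fun g => ?_⟩
  have hc : ‖c g‖ = 1 := by
    refine (hU g).1.norm_eq_one_of_smul_pow_eq_one (Nat.card_pos (α := G)).ne' ?_
    rw [← hρ, ← map_pow, pow_card_eq_one', map_one]
  rw [isPropagator_iff hκ h, hρ]
  exact ⟨(hU g).1.smul hc, (hint g).smul (c g)⟩

theorem exists_representation_and_forall_exists_circle_smul {G : Type*} [Group G] [Finite G]
    (hκ : IsWeylPhase N κ) (h : N ∣ M) (hN : N = q * r * m) (hm : Odd m)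
    (f : G →* symplecticGroup (Fin d) (ZMod M))
    (hf : ∀ g, ∀ n ∈ phaseFreeSet d κ (r * m) (q * m),
      n ᵥ* (f g).1 ∈ phaseFreeSet d κ (r * m) (q * m)) :
    (∃ ρ : Representation ℂ G (StateSpace N d), ∀ g, IsPropagator N (f g).1 (ρ g)) ∧
      ∀ U : G → Module.End ℂ (StateSpace N d), (∀ g, IsPropagator N (f g).1 (U g)) →
        ∃ (c : G → Circle) (ρ : Representation ℂ G (StateSpace N d)),
          ∀ g, ρ g = (c g : ℂ) • U g := by
  obtain ⟨ρ, hρ⟩ := exists_representation_isPropagator hκ h hN hm f hf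
  refine ⟨⟨ρ, hρ⟩, fun U hU => ?_⟩
  choose c hc using fun g => (hρ g).exists_circle_smul hκ h (hU g)
  exact ⟨c, ρ, hc⟩

end Representation

/-! ### Matrices congruent to plus or minus the identity -/

section Congruence

variable {M d : ℕ} {κ : AddChar (ZMod M) ℂ}

theorem exists_eq_mul_mul_mul_odd {n : ℕ} (hn : n ≠ 0) :
    ∃ q c e m : ℕ, c * e = 2 ∧ Odd m ∧ n = q * (q * c) * m := by
  obtain ⟨k, m, hm, rfl⟩ := Nat.exists_eq_two_pow_mul_odd hn
  rcases Nat.even_or_odd' k with ⟨j, rfl | rfl⟩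
  · exact ⟨2 ^ j, 1, 2, m, rfl, hm, by ring⟩
  · exact ⟨2 ^ j, 2, 1, m, rfl, hm, by ring⟩

theorem exists_eq_add_nsmul_of_map_castHom_eq {m : ℕ} {ι : Type*} (h : m ∣ M)
    {A E : Matrix ι ι (ZMod M)}
    (hA : A.map (ZMod.castHom h (ZMod m)) = E.map (ZMod.castHom h (ZMod m))) :
    ∃ B : Matrix ι ι (ZMod M), A = E + m • B := by
  have hentry (i j : ι) : ∃ b, A i j = E i j + m • b := by
    obtain ⟨t, ht⟩ := ZMod.intCast_surjective (A i j - E i j)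
    have hzero : ZMod.castHom h (ZMod m) (t : ZMod M) = 0 := by
      rw [ht, map_sub, sub_eq_zero]
      exact congrFun₂ hA i j
    rw [map_intCast, ZMod.intCast_zmod_eq_zero_iff_dvd] at hzero
    obtain ⟨s, rfl⟩ := hzero
    refine ⟨s, eq_add_of_sub_eq' ?_⟩
    rw [← ht, Int.cast_mul, Int.cast_natCast, nsmul_eq_mul]
  choose B hB using hentry
  exact ⟨Matrix.of B, Matrix.ext hB⟩

theorem exists_eq_smul_one_add_nsmul_of_mem_pmOneSubgroup {m : ℕ} {h : m ∣ M}
    {A : symplecticGroup (Fin d) (ZMod M)} (hA : A ∈ pmOneSubgroup d h) :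
    ∃ (ε : ℤ) (B : Matrix (Fin d ⊕ Fin d) (Fin d ⊕ Fin d) (ZMod M)),
      ε * ε = 1 ∧ A.1 = ε • 1 + m • B := by
  have hone : (1 : Matrix (Fin d ⊕ Fin d) (Fin d ⊕ Fin d) (ZMod M)).map
      (ZMod.castHom h (ZMod m)) = 1 := Matrix.map_one _ (map_zero _) (map_one _)
  rcases hA with hA | hA
  · obtain ⟨B, hB⟩ := exists_eq_add_nsmul_of_map_castHom_eq h (hA.trans hone.symm)
    exact ⟨1, B, rfl, by rw [hB, one_smul]⟩
  · have hneg : (-1 : Matrix (Fin d ⊕ Fin d) (Fin d ⊕ Fin d) (ZMod M)).map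
        (ZMod.castHom h (ZMod m)) = -1 := by
      rw [Matrix.map_neg _ (map_neg _), hone]
    obtain ⟨B, hB⟩ := exists_eq_add_nsmul_of_map_castHom_eq h (hA.trans hneg.symm)
    exact ⟨-1, B, rfl, by rw [hB, neg_one_smul]⟩

theorem phaseFreeSet_self : phaseFreeSet d κ M M = {0} := by
  have hM (a : Fin d → ZMod M) : M • a = 0 := ZModModule.char_nsmul_eq_zero M a
  ext n
  simp [phaseFreeSet, hM]

theorem vecMul_mem_phaseFreeSet {s t c e : ℕ} (hce : c * e = 2) (hs : s = c * t)
    (hM : M ∣ 2 * (s * t)) {ε : ℤ} (hε : ε * ε = 1)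
    {A B : Matrix (Fin d ⊕ Fin d) (Fin d ⊕ Fin d) (ZMod M)} (hA : A = ε • 1 + 4 • B)
    {n : Fin d ⊕ Fin d → ZMod M} (hn : n ∈ phaseFreeSet d κ s t) :
    n ᵥ* A ∈ phaseFreeSet d κ s t := by
  obtain ⟨a, b, rfl, hab⟩ := hn
  let w := Sum.elim (c • a) b ᵥ* B
  let x := e • (w ∘ Sum.inl)
  let y := 2 • (w ∘ Sum.inr)
  have hce' : (c : ZMod M) * e = 2 := by exact_mod_cast congrArg (Nat.cast : ℕ → ZMod M) hce
  have hε' : (ε : ZMod M) * ε = 1 := by exact_mod_cast congrArg (Int.cast : ℤ → ZMod M) hε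
  have hM' : (2 : ZMod M) * (s * t) = 0 := by exact_mod_cast (ZMod.natCast_eq_zero_iff _ M).2 hM
  have hw : Sum.elim (s • a) (t • b) ᵥ* B = t • w := by
    rw [← smul_vecMul, hs, mul_comm c, mul_smul]
    congr 1
    ext (i | i) <;> rfl
  refine ⟨ε • a + 2 • x, ε • b + 2 • y, ?_, ?_⟩
  · rw [hA, vecMul_add, vecMul_smul, vecMul_smul, vecMul_one, hw]
    ext (i | i)
    · change ε • s • a i + 4 • t • w (Sum.inl i) = s • (ε • a i + 2 • e • w (Sum.inl i))
      simp only [hs, nsmul_eq_mul, zsmul_eq_mul, Nat.cast_mul, Nat.cast_ofNat]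
      linear_combination (-2 * t * w (Sum.inl i)) * hce'
    · change ε • t • b i + 4 • t • w (Sum.inr i) = t • (ε • b i + 2 • 2 • w (Sum.inr i))
      module
  · rw [← hab]
    congr 1
    simp only [smul_dotProduct, dotProduct_smul, add_dotProduct, dotProduct_add]
    simp only [nsmul_eq_mul, zsmul_eq_mul, Nat.cast_ofNat]
    linear_combination (s * t * (a ⬝ᵥ b)) * hε' +
      (ε * (a ⬝ᵥ y) + ε * (x ⬝ᵥ b) + 2 * (x ⬝ᵥ y)) * hM'

end Congruence

theorem mainTheorem5 (d N : ℕ) [NeZero N] (hN : 1 < N) :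
    (Odd N →
      (∃ ρ : Representation ℂ (symplecticGroup (Fin d) (ZMod N)) (StateSpace N d),
        ∀ A : symplecticGroup (Fin d) (ZMod N),
          IsPropagator N (A : Matrix (Fin d ⊕ Fin d) (Fin d ⊕ Fin d) (ZMod N)) (ρ A)) ∧
      (∀ U : symplecticGroup (Fin d) (ZMod N) → Module.End ℂ (StateSpace N d),
        (∀ A : symplecticGroup (Fin d) (ZMod N),
          IsPropagator N (A : Matrix (Fin d ⊕ Fin d) (Fin d ⊕ Fin d) (ZMod N)) (U A)) →
        ∃ c : symplecticGroup (Fin d) (ZMod N) → Circle,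
          ∃ ρ : Representation ℂ (symplecticGroup (Fin d) (ZMod N)) (StateSpace N d),
            ∀ A, ρ A = (c A : ℂ) • U A)) ∧
    (∀ h : Even N,
      (∃ ρ : Representation ℂ (pmOneSubgroup d (four_dvd_two_mul_of_even h)) (StateSpace N d),
        ∀ A : pmOneSubgroup d (four_dvd_two_mul_of_even h),
          IsPropagator N (A.1 : Matrix (Fin d ⊕ Fin d) (Fin d ⊕ Fin d) (ZMod (2 * N))) (ρ A)) ∧
      (∀ U : pmOneSubgroup d (four_dvd_two_mul_of_even h) → Module.End ℂ (StateSpace N d),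
        (∀ A : pmOneSubgroup d (four_dvd_two_mul_of_even h),
          IsPropagator N (A.1 : Matrix (Fin d ⊕ Fin d) (Fin d ⊕ Fin d) (ZMod (2 * N))) (U A)) →
        ∃ c : pmOneSubgroup d (four_dvd_two_mul_of_even h) → Circle,
          ∃ ρ : Representation ℂ (pmOneSubgroup d (four_dvd_two_mul_of_even h)) (StateSpace N d),
            ∀ A, ρ A = (c A : ℂ) • U A)) := by
  constructor
  · intro hodd
    obtain ⟨κ, hκ⟩ := exists_isWeylPhase_of_odd hodd
    refine exists_representation_and_forall_exists_circle_smul hκ dvd_rfl (q := 1) (r := 1)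
      (by ring) hodd (MonoidHom.id _) fun A n hn => ?_
    obtain rfl : n = 0 := by simpa [phaseFreeSet_self] using hn
    rwa [zero_vecMul]
  · intro h
    obtain ⟨κ, hκ⟩ := exists_isWeylPhase_two_mul N
    obtain ⟨q, c, e, m, hce, hm, hqm⟩ := exists_eq_mul_mul_mul_odd (NeZero.ne N)
    refine exists_representation_and_forall_exists_circle_smul hκ (dvd_mul_left N 2) hqm hm
      (Subgroup.subtype _) fun A n hn => ?_
    obtain ⟨ε, B, hε, hB⟩ := exists_eq_smul_one_add_nsmul_of_mem_pmOneSubgroup A.2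
    exact vecMul_mem_phaseFreeSet hce (by ring) ⟨m, by rw [hqm]; ring⟩ hε hB hn
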